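/- For an integer $n\ge 1$ and $s\in\mathbb{C}$ put $$S_n(s)=\sum_{k=0}^{n-1}(-1)^k\binom{n-1}{k}(k+1)^{-s},\qquad \Delta_n(s)=\sum_{k=1}^{n}(-1)^k\binom{n}{k}k^{1-s}.$$ Let $\zeta$ be the Riemann zeta function, and let $(s-1)\zeta(s)$ denote the entire function whose value at $s=1$ is $\lim_{s\to 1}(s-1)\zeta(s)=1$. Then for all $s\in\mathbb{C}$, $$(s-1)\zeta(s)=\sum_{n=1}^{\infty}\frac{1}{n+1}S_n(s)=-\sum_{n=1}^{\infty}\frac{1}{n(n+1)}\Delta_n(s).$$ Moreover, both series converge uniformly and absolutely on compact subsets of the $s$-plane: on every compact set $K\subset\mathbb{C}$, the series converge uniformly to the stated sums, and the series of the absolute values of their terms also converge uniformly. -/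

import Mathlib

/-- `S_n(s) = ∑_{k=0}^{n-1} (-1)^k * C(n-1, k) * (k+1)^(-s)`, used for `n ≥ 1`. -/
noncomputable def serS (n : ℕ) (s : ℂ) : ℂ :=
  ∑ k ∈ Finset.range n, (-1 : ℂ) ^ k * ((n - 1).choose k : ℂ) * ((k : ℂ) + 1) ^ (-s)

/-- `Δ_n(s) = ∑_{k=1}^{n} (-1)^k * C(n, k) * k^(1-s)`, used for `n ≥ 1`. -/
noncomputable def serDelta (n : ℕ) (s : ℂ) : ℂ :=
  ∑ k ∈ Finset.Icc 1 n, (-1 : ℂ) ^ k * (n.choose k : ℂ) * (k : ℂ) ^ (1 - s)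

/-- The entire function `(s - 1) ζ(s)`. Since `ζ` has a simple pole with residue `1` at `s = 1`, its
value there is `1` (the literal product in Mathlib would be `0` at `s = 1`). -/
noncomputable def subOneMulZeta : ℂ → ℂ :=
  Function.update (fun s : ℂ => (s - 1) * riemannZeta s) 1 1

/-- The value `1` at `s = 1` is the one that makes `(s - 1) ζ(s)` an entire function. -/
theorem differentiable_subOneMulZeta : Differentiable ℂ subOneMulZeta := by
  have hc : ContinuousAt subOneMulZeta 1 := by
    unfold subOneMulZeta
    rw [continuousAt_update_same]
    exact riemannZeta_residue_one
  have hd : DifferentiableOn ℂ subOneMulZeta (Set.univ \ {1}) := by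
    intro s hs
    have hs1 : s ≠ 1 := by simpa using hs
    have h : DifferentiableAt ℂ (fun s : ℂ => (s - 1) * riemannZeta s) s :=
      (differentiableAt_id.sub_const 1).mul (differentiableAt_riemannZeta hs1)
    refine (h.congr_of_eventuallyEq ?_).differentiableWithinAt
    filter_upwards [isOpen_ne.mem_nhds hs1] with z hz
    exact Function.update_of_ne hz _ _
  exact differentiableOn_univ.1
    ((Complex.differentiableOn_compl_singleton_and_continuousAt_iff Filter.univ_mem).1 ⟨hd, hc⟩)

/-- The `n`-th term `S_n(s) / (n+1)` of the first series. -/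
noncomputable def termS (n : ℕ) (s : ℂ) : ℂ :=
  serS n s / ((n : ℂ) + 1)

/-- The `n`-th term `Δ_n(s) / (n (n+1))` of the second series. -/
noncomputable def termDelta (n : ℕ) (s : ℂ) : ℂ :=
  serDelta n s / ((n : ℂ) * ((n : ℂ) + 1))

/-! With `A i n s` for `shiftedAltSum i n s`, both n-th terms are `± A 0 (n-1) s / (n+1)`, so one
series suffices. For `0 < Re s`, `Γ(s) * A i n s` is the Mellin transform of `e^{-(i+1)t} (1 -
e^{-t})^n`; for `1 ≤ Re s` this yields `A i n s = O((n+1)^{-(i+1/4)})`, uniformly on bounded sets. A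
recurrence from `s + 1` to `s` costs a factor `n` but raises `i` by one, so the bound spreads to all
of `ℂ`. At `i = 0` the terms are `O(n^{-5/4})`: the Weierstrass test gives the convergence and an
entire sum. For `1 < Re s`, summing under the integral with `∑ u^n/(n+2) = (-log(1-u) - u)/u²` and
`u = 1 - e^{-t}` gives `Γ(s)(s-1)ζ(s)`. The identity theorem does the rest. -/

open Finset in
/-- The alternating binomial sum `∑ (-1)^k C(n, k) (k + i + 1)^(-s)`. -/
noncomputable def shiftedAltSum (i n : ℕ) (s : ℂ) : ℂ :=
  ∑ k ∈ range (n + 1), (-1 : ℂ) ^ k * (n.choose k : ℂ) * ((k + i + 1 : ℕ) : ℂ) ^ (-s)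

/-! ### Recurrence in `s`, and reduction of both series to one -/

theorem natCast_cpow_neg_eq_mul (m : ℕ) (hm : m ≠ 0) (s : ℂ) :
    (m : ℂ) ^ (-s) = m * (m : ℂ) ^ (-(s + 1)) := by
  have h : (m : ℂ) ≠ 0 := Nat.cast_ne_zero.2 hm
  rw [show -s = 1 + -(s + 1) by ring, Complex.cpow_add _ _ h, Complex.cpow_one]

theorem shiftedAltSum_zero (i : ℕ) (s : ℂ) :
    shiftedAltSum i 0 s = (i + 1) * shiftedAltSum i 0 (s + 1) := by
  simpa [shiftedAltSum] using natCast_cpow_neg_eq_mul (i + 1) (by omega) s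

/-- Split the base as `(i + 1) + k` and absorb `k` through `k * C(n+1, k) = (n+1) * C(n, k-1)`. -/
theorem shiftedAltSum_succ (i n : ℕ) (s : ℂ) :
    shiftedAltSum i (n + 1) s =
      (i + 1) * shiftedAltSum i (n + 1) (s + 1) - (n + 1) * shiftedAltSum (i + 1) n (s + 1) := by
  have key : ∑ k ∈ Finset.range (n + 1 + 1), (k : ℂ) * ((-1 : ℂ) ^ k * ((n + 1).choose k : ℂ) *
      ((k + i + 1 : ℕ) : ℂ) ^ (-(s + 1))) = -((n + 1) * shiftedAltSum (i + 1) n (s + 1)) := by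
    rw [Finset.sum_range_succ', shiftedAltSum, Finset.mul_sum]
    simp only [Nat.cast_zero, zero_mul, add_zero]
    rw [← Finset.sum_neg_distrib]
    refine Finset.sum_congr rfl fun k _ => ?_
    have h : ((n : ℂ) + 1) * (n.choose k : ℂ) = ((n + 1).choose (k + 1) : ℂ) * (k + 1) := by
      exact_mod_cast Nat.add_one_mul_choose_eq n k
    rw [show k + 1 + i + 1 = k + (i + 1) + 1 by ring, pow_succ]
    push_cast
    linear_combination (-(-1 : ℂ) ^ k * ((k : ℂ) + (i + 1) + 1) ^ (-(s + 1))) * -h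
  rw [sub_eq_add_neg, ← key, shiftedAltSum, shiftedAltSum, Finset.mul_sum,
    ← Finset.sum_add_distrib]
  refine Finset.sum_congr rfl fun k _ => ?_
  rw [natCast_cpow_neg_eq_mul _ (by omega) s]
  push_cast
  ring

theorem differentiable_shiftedAltSum (i n : ℕ) : Differentiable ℂ (shiftedAltSum i n) := by
  unfold shiftedAltSum
  refine Differentiable.fun_sum fun k _ => (Differentiable.const_cpow differentiable_neg
    (Or.inl (Nat.cast_ne_zero.2 (by omega)))).const_mul _

theorem serS_succ (n : ℕ) (s : ℂ) : serS (n + 1) s = shiftedAltSum 0 n s := by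
  simp [serS, shiftedAltSum]

theorem serDelta_succ (n : ℕ) (s : ℂ) :
    serDelta (n + 1) s = -((n + 1) * shiftedAltSum 0 n s) := by
  have hI : Finset.Icc 1 (n + 1) = Finset.Ico (0 + 1) (n + 1 + 1) := by ext; simp
  rw [serDelta, hI, ← Finset.sum_Ico_add', ← Finset.range_eq_Ico, shiftedAltSum, Finset.mul_sum,
    ← Finset.sum_neg_distrib]
  refine Finset.sum_congr rfl fun k _ => ?_
  have h : ((n : ℂ) + 1) * (n.choose k : ℂ) = ((n + 1).choose (k + 1) : ℂ) * (k + 1) := by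
    exact_mod_cast Nat.add_one_mul_choose_eq n k
  rw [sub_eq_add_neg, Complex.cpow_add _ _ (Nat.cast_ne_zero.2 k.succ_ne_zero), Complex.cpow_one,
    pow_succ, add_zero]
  push_cast
  linear_combination ((-1 : ℂ) ^ k * ((k : ℂ) + 1) ^ (-s)) * h

theorem termS_succ (n : ℕ) (s : ℂ) : termS (n + 1) s = shiftedAltSum 0 n s / (n + 2) := by
  rw [termS, serS_succ]
  push_cast
  ring

theorem termDelta_succ (n : ℕ) (s : ℂ) : termDelta (n + 1) s = -termS (n + 1) s := by
  have h : (n : ℂ) + 1 ≠ 0 := Nat.cast_add_one_ne_zero n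
  have h2 : (n : ℂ) + 1 + 1 ≠ 0 := by exact_mod_cast Nat.cast_add_one_ne_zero (R := ℂ) (n + 1)
  rw [termDelta, serDelta_succ, termS, serS_succ]
  push_cast
  field_simp

/-! ### Pointwise bounds for the Mellin integrand -/

open Real in
theorem rpow_le_factorial_mul_exp {y b : ℝ} {N : ℕ} (hy : 0 < y) (hb : 0 ≤ b) (hbN : b ≤ N) :
    y ^ b ≤ N.factorial * exp y := by
  rcases le_total y 1 with h | h
  · calc y ^ b ≤ 1 := rpow_le_one hy.le h hb
      _ ≤ N.factorial * exp y := one_le_mul_of_one_le_of_one_le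
          (by exact_mod_cast N.factorial_pos) (one_le_exp hy.le)
  · have := pow_div_factorial_le_exp y hy.le N
    rw [div_le_iff₀ (by positivity)] at this
    calc y ^ b ≤ y ^ (N : ℝ) := rpow_le_rpow_of_exponent_le h hbN
      _ = y ^ N := rpow_natCast _ _
      _ ≤ _ := by linarith

-- With `x = (n+1) e^{-t}` and `a = i + 1/4`, the left side is at most `e (n+1)^{-a} x^a e^{-x}`,
-- and `x^a e^{-x} ≤ (i+1)!`. Taking `a` below `i + 1` saves some exponential decay for
-- integrability.
open Real in
theorem exp_neg_mul_rpow_mul_pow_le (i n : ℕ) {t : ℝ} (ht : 0 < t) :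
    exp (-((i + 1 / 4) * t)) * (1 - exp (-t)) ^ n ≤
      (i + 1).factorial * exp 1 * ((n : ℝ) + 1) ^ (-((i : ℝ) + 1 / 4)) := by
  set a : ℝ := i + 1 / 4 with ha
  have hn : (0 : ℝ) < n + 1 := by positivity
  have hu1 : exp (-t) ≤ 1 := exp_le_one_iff.2 (by linarith)
  have h1 : (1 - exp (-t)) ^ n ≤ exp 1 * exp (-((n + 1) * exp (-t))) := by
    calc (1 - exp (-t)) ^ n ≤ (exp (-exp (-t))) ^ n :=
          pow_le_pow_left₀ (by linarith) (one_sub_le_exp_neg _) n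
      _ = exp (-(n * exp (-t))) := by rw [← exp_nat_mul]; ring_nf
      -- Passing from `n` to `n + 1`, which also covers `n = 0`, costs at most `e` since `e^{-t} ≤
      -- 1`.
      _ ≤ exp 1 * exp (-((n + 1) * exp (-t))) := by
          rw [← exp_add]; exact exp_le_exp.2 (by linarith)
  have h2 := rpow_le_factorial_mul_exp (y := (n + 1) * exp (-t)) (b := a) (N := i + 1)
    (by positivity) (by positivity) (by push_cast; linarith)
  rw [mul_rpow hn.le (exp_pos _).le, ← exp_mul, show -t * a = -(a * t) by ring] at h2
  calc exp (-(a * t)) * (1 - exp (-t)) ^ n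
      ≤ exp (-(a * t)) * (exp 1 * exp (-((n + 1) * exp (-t)))) := by gcongr
    _ = (((n : ℝ) + 1) ^ a * exp (-(a * t))) *
          (exp 1 * exp (-((n + 1) * exp (-t)))) * ((n : ℝ) + 1) ^ (-a) := by
        rw [rpow_neg hn.le]; field_simp
    _ ≤ ((i + 1).factorial * exp ((n + 1) * exp (-t))) *
          (exp 1 * exp (-((n + 1) * exp (-t)))) * ((n : ℝ) + 1) ^ (-a) := by gcongr
    _ = _ := by rw [exp_neg ((n + 1) * exp (-t))]; field_simp

open Real in
/-- Domination of the Mellin integrand of `e^{-(i+1)t} (1 - e^{-t})^n`. -/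
theorem rpow_mul_exp_mul_pow_le (i n N : ℕ) {σ t : ℝ} (ht : 0 < t) (hσ : 1 ≤ σ) (hσN : σ - 1 ≤ N) :
    t ^ (σ - 1) * (exp (-((i + 1) * t)) * (1 - exp (-t)) ^ n) ≤
      2 ^ N * N.factorial * ((i + 1).factorial * exp 1) * ((n : ℝ) + 1) ^ (-((i : ℝ) + 1 / 4)) *
        exp (-(1 / 4) * t) := by
  have h1 : t ^ (σ - 1) ≤ 2 ^ N * N.factorial * exp (t / 2) := by
    calc t ^ (σ - 1) = 2 ^ (σ - 1) * (t / 2) ^ (σ - 1) := by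
          rw [← mul_rpow (by norm_num) (by positivity)]; ring_nf
      _ ≤ 2 ^ (N : ℝ) * (N.factorial * exp (t / 2)) := by
          gcongr
          · norm_num
          · exact rpow_le_factorial_mul_exp (by positivity) (by linarith) hσN
      _ = _ := by rw [rpow_natCast]; ring
  have h2 := exp_neg_mul_rpow_mul_pow_le i n ht
  have h3 : 0 ≤ (1 - exp (-t)) ^ n :=
    pow_nonneg (sub_nonneg.2 (exp_le_one_iff.2 (by linarith))) n
  calc t ^ (σ - 1) * (exp (-((i + 1) * t)) * (1 - exp (-t)) ^ n)
      ≤ (2 ^ N * N.factorial * exp (t / 2)) * (exp (-((i + 1) * t)) * (1 - exp (-t)) ^ n) := by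
        gcongr
    _ = (2 ^ N * N.factorial) * exp (-(1 / 4) * t) *
          (exp (-((i + 1 / 4) * t)) * (1 - exp (-t)) ^ n) := by
        -- The factor `e^{-t/2}` cancels the growth allowed to `t^(σ-1)`; `e^{-t/4}` is kept for
        -- integrating.
        rw [show exp (-((i + 1) * t)) = exp (-(1 / 4) * t) * exp (-((i + 1 / 4) * t)) *
          exp (-(t / 2)) by rw [← exp_add, ← exp_add]; ring_nf, exp_neg (t / 2)]
        field_simp
    _ ≤ (2 ^ N * N.factorial) * exp (-(1 / 4) * t) * ((i + 1).factorial * exp 1 *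
          ((n : ℝ) + 1) ^ (-((i : ℝ) + 1 / 4))) := by gcongr
    _ = _ := by ring

/-- The function whose Mellin transform is `Γ(s)` times `shiftedAltSum i n s`. -/
noncomputable def expWeight (i n : ℕ) (t : ℝ) : ℂ :=
  ((Real.exp (-((i + 1) * t)) * (1 - Real.exp (-t)) ^ n : ℝ) : ℂ)

/-! ### Mellin representation of the alternating sums -/

open Set MeasureTheory

theorem expWeight_eq_sum (i n : ℕ) (t : ℝ) :
    expWeight i n t = ∑ k ∈ Finset.range (n + 1), ((-1 : ℂ) ^ k * (n.choose k : ℂ)) *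
      (Real.exp (-((k + i + 1 : ℕ) : ℝ) * t) : ℂ) := by
  have h : (1 - Real.exp (-t)) ^ n = ∑ k ∈ Finset.range (n + 1),
      (-1 : ℝ) ^ k * (n.choose k : ℝ) * Real.exp (-(k * t)) := by
    rw [sub_eq_neg_add, add_pow]
    refine Finset.sum_congr rfl fun k _ => ?_
    rw [neg_pow, ← Real.exp_nat_mul]
    ring_nf
  rw [expWeight, h, Finset.mul_sum, Complex.ofReal_sum]
  refine Finset.sum_congr rfl fun k _ => ?_
  rw [show -((k + i + 1 : ℕ) : ℝ) * t = -((i + 1) * t) + -(k * t) by push_cast; ring, Real.exp_add]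
  push_cast
  ring

theorem mellin_expWeight (i n : ℕ) {s : ℂ} (hs : 0 < s.re) :
    mellin (expWeight i n) s = Complex.Gamma s * shiftedAltSum i n s := by
  have h := hasSum_mellin (ι := Fin (n + 1)) (a := fun k => (-1 : ℂ) ^ (k : ℕ) * (n.choose k : ℂ))
    (p := fun k => ((k + i + 1 : ℕ) : ℝ)) (F := expWeight i n) (s := s)
    (fun k => Or.inr (by positivity)) hs (fun t _ => by
      rw [expWeight_eq_sum, ← Fin.sum_univ_eq_sum_range (fun k => ((-1 : ℂ) ^ k *
        (n.choose k : ℂ)) * (Real.exp (-((k + i + 1 : ℕ) : ℝ) * t) : ℂ))]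
      exact hasSum_fintype _) Summable.of_finite
  rw [← h.tsum_eq, tsum_fintype, shiftedAltSum, Finset.mul_sum, Fin.sum_univ_eq_sum_range
    (fun k => Complex.Gamma s * ((-1 : ℂ) ^ k * (n.choose k : ℂ)) /
      ((((k + i + 1 : ℕ) : ℝ) : ℂ)) ^ s)]
  refine Finset.sum_congr rfl fun k _ => ?_
  rw [Complex.cpow_neg]
  push_cast
  ring

theorem norm_mellin_expWeight_integrand_le (i n N : ℕ) {s : ℂ} {t : ℝ} (ht : 0 < t)
    (hs : 1 ≤ s.re) (hsN : s.re - 1 ≤ N) :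
    ‖(t : ℂ) ^ (s - 1) • expWeight i n t‖ ≤
      2 ^ N * N.factorial * ((i + 1).factorial * Real.exp 1) *
        ((n : ℝ) + 1) ^ (-((i : ℝ) + 1 / 4)) * Real.exp (-(1 / 4) * t) := by
  refine le_trans (le_of_eq ?_) (rpow_mul_exp_mul_pow_le i n N ht hs hsN)
  rw [smul_eq_mul, norm_mul, Complex.norm_cpow_eq_rpow_re_of_pos ht, expWeight,
    Complex.norm_real, Real.norm_of_nonneg, Complex.sub_re, Complex.one_re]
  exact mul_nonneg (Real.exp_pos _).le
    (pow_nonneg (sub_nonneg.2 (Real.exp_le_one_iff.2 (by linarith))) n)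

theorem integrableOn_exp_neg_quarter :
    IntegrableOn (fun t : ℝ => Real.exp (-(1 / 4) * t)) (Ioi 0) :=
  exp_neg_integrableOn_Ioi 0 (by norm_num)

theorem integral_exp_neg_quarter : ∫ t : ℝ in Ioi 0, Real.exp (-(1 / 4) * t) = 4 := by
  rw [integral_exp_mul_Ioi (by norm_num) 0]
  norm_num

theorem integral_norm_mellin_expWeight_le (i n N : ℕ) {s : ℂ}
    (hs : 1 ≤ s.re) (hsN : s.re - 1 ≤ N) :
    ∫ t : ℝ in Ioi 0, ‖(t : ℂ) ^ (s - 1) • expWeight i n t‖ ≤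
      2 ^ N * N.factorial * ((i + 1).factorial * Real.exp 1) * 4 *
        ((n : ℝ) + 1) ^ (-((i : ℝ) + 1 / 4)) := by
  calc _ ≤ ∫ t : ℝ in Ioi 0, 2 ^ N * N.factorial * ((i + 1).factorial * Real.exp 1) *
        ((n : ℝ) + 1) ^ (-((i : ℝ) + 1 / 4)) * Real.exp (-(1 / 4) * t) :=
        integral_mono_of_nonneg (Filter.Eventually.of_forall fun _ => norm_nonneg _)
          (integrableOn_exp_neg_quarter.const_mul _)
          ((ae_restrict_iff' measurableSet_Ioi).2 (Filter.Eventually.of_forall fun t ht =>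
            norm_mellin_expWeight_integrand_le i n N ht hs hsN))
    _ = _ := by rw [integral_const_mul, integral_exp_neg_quarter]; ring

/-! ### Locally uniform decay in `n` on the whole plane -/

theorem exists_norm_shiftedAltSum_le_of_one_le_re (R : ℝ) (i : ℕ) :
    ∃ C : ℝ, ∀ (s : ℂ) (n : ℕ), 1 ≤ s.re → ‖s‖ ≤ R →
      ‖shiftedAltSum i n s‖ ≤ C * ((n : ℝ) + 1) ^ (-((i : ℝ) + 1 / 4)) := by
  -- `1/Γ` is entire, so dividing by `Γ` costs only a constant on the ball.
  obtain ⟨G, hG⟩ := (isCompact_closedBall (0 : ℂ) R).exists_bound_of_continuousOn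
    Complex.differentiable_one_div_Gamma.continuous.continuousOn
  obtain ⟨N, hN⟩ := exists_nat_ge R
  refine ⟨G * (2 ^ N * N.factorial * ((i + 1).factorial * Real.exp 1) * 4), fun s n hs hR => ?_⟩
  have hGs := hG s (by simpa using hR)
  have hne := Complex.Gamma_ne_zero_of_re_pos (s := s) (by linarith)
  have h1 : shiftedAltSum i n s = (Complex.Gamma s)⁻¹ * mellin (expWeight i n) s := by
    rw [mellin_expWeight i n (by linarith), inv_mul_cancel_left₀ hne]
  have h2 : ‖mellin (expWeight i n) s‖ ≤ _ := (norm_integral_le_integral_norm _).trans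
    (integral_norm_mellin_expWeight_le i n N hs (by linarith [Complex.re_le_norm s]))
  rw [h1, norm_mul, mul_assoc G]
  exact mul_le_mul hGs h2 (norm_nonneg _) ((norm_nonneg _).trans hGs)

/-- Each use of the recurrence moves the half-plane one unit left. It needs the radius `R + 1` and
the index `i + 1`, hence the quantifiers inside the induction. -/
theorem exists_norm_shiftedAltSum_le_of_le_re (m : ℕ) : ∀ (R : ℝ) (i : ℕ),
    ∃ C : ℝ, ∀ (s : ℂ) (n : ℕ), 1 - (m : ℝ) ≤ s.re → ‖s‖ ≤ R →
      ‖shiftedAltSum i n s‖ ≤ C * ((n : ℝ) + 1) ^ (-((i : ℝ) + 1 / 4)) := by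
  induction m with
  | zero => simpa using exists_norm_shiftedAltSum_le_of_one_le_re
  | succ m ih =>
    intro R i
    obtain ⟨C₁, h₁⟩ := ih (R + 1) i
    obtain ⟨C₂, h₂⟩ := ih (R + 1) (i + 1)
    refine ⟨(i + 1) * C₁ + |C₂| * 2 ^ ((i : ℝ) + 1 / 4), fun s n hs hR => ?_⟩
    have hs' : 1 - (m : ℝ) ≤ (s + 1).re := by
      push_cast at hs; rw [Complex.add_re, Complex.one_re]; linarith
    have hR' : ‖s + 1‖ ≤ R + 1 := (norm_add_le _ _).trans (by simpa using hR)
    have hi : ‖((i : ℂ) + 1)‖ = i + 1 := by exact_mod_cast Complex.norm_natCast (i + 1)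
    have b₁ := h₁ (s + 1) n hs' hR'
    have c₁ : ‖((i : ℂ) + 1) * shiftedAltSum i n (s + 1)‖ ≤
        (i + 1) * C₁ * ((n : ℝ) + 1) ^ (-((i : ℝ) + 1 / 4)) := by
      rw [norm_mul, hi, mul_assoc]; gcongr
    rw [add_mul]
    cases n with
    | zero =>
      rw [shiftedAltSum_zero]
      exact c₁.trans (le_add_of_nonneg_right (by positivity))
    | succ n =>
      have b₂ := h₂ (s + 1) n hs' hR'
      have hn : ‖((n : ℂ) + 1)‖ = n + 1 := by exact_mod_cast Complex.norm_natCast (n + 1)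
      rw [shiftedAltSum_succ]
      refine (norm_sub_le _ _).trans (add_le_add c₁ ?_)
      rw [norm_mul, hn]
      set a : ℝ := (i : ℝ) + 1 / 4 with ha
      have hpos : (0 : ℝ) < n + 1 := by positivity
      calc ((n : ℝ) + 1) * ‖shiftedAltSum (i + 1) n (s + 1)‖
          ≤ ((n : ℝ) + 1) * (|C₂| * ((n : ℝ) + 1) ^ (-(a + 1))) := by
            gcongr
            refine b₂.trans ?_
            rw [show -(((i + 1 : ℕ) : ℝ) + 1 / 4) = -(a + 1) by push_cast; ring]
            gcongr
            exact le_abs_self _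
        _ = |C₂| * ((n : ℝ) + 1) ^ (-a) := by
            rw [show -a = 1 + -(a + 1) by ring, Real.rpow_add hpos, Real.rpow_one]; ring
        -- The recurrence lowers the index by one; `n + 2 ≤ 2(n + 1)` restores it at the cost of
        -- `2^a`.
        _ ≤ |C₂| * (2 ^ a * (((n + 1 : ℕ) : ℝ) + 1) ^ (-a)) := by
            gcongr
            rw [Real.rpow_neg hpos.le, Real.rpow_neg (by positivity), ← div_eq_mul_inv,
              ← Real.div_rpow (by positivity) (by positivity), ← Real.inv_rpow hpos.le]
            refine Real.rpow_le_rpow (by positivity) ?_ (by positivity)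
            rw [inv_eq_one_div, div_le_div_iff₀ hpos (by positivity)]
            push_cast
            linarith
        _ = _ := by ring

theorem exists_norm_shiftedAltSum_le (R : ℝ) (i : ℕ) :
    ∃ C : ℝ, ∀ (s : ℂ) (n : ℕ), ‖s‖ ≤ R →
      ‖shiftedAltSum i n s‖ ≤ C * ((n : ℝ) + 1) ^ (-((i : ℝ) + 1 / 4)) := by
  obtain ⟨m, hm⟩ := exists_nat_ge (R + 1)
  obtain ⟨C, hC⟩ := exists_norm_shiftedAltSum_le_of_le_re m R i
  refine ⟨C, fun s n hR => hC s n ?_ hR⟩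
  linarith [neg_abs_le s.re, Complex.abs_re_le_norm s]

theorem summable_rpow_neg_quarter_div (C : ℝ) :
    Summable fun n : ℕ => C * ((n : ℝ) + 1) ^ (-((0 : ℕ) + 1 / 4 : ℝ)) / (n + 2) := by
  have h := ((summable_nat_add_iff 1).2
    (Real.summable_nat_rpow_inv.2 (by norm_num : (1 : ℝ) < 5 / 4))).mul_left |C|
  refine Summable.of_norm_bounded h fun n => ?_
  have hpos : (0 : ℝ) < n + 1 := by positivity
  rw [norm_div, norm_mul, Real.norm_eq_abs C, Real.norm_of_nonneg (by positivity),
    Real.norm_of_nonneg (by positivity), mul_div_assoc]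
  gcongr
  push_cast
  rw [← Real.rpow_neg hpos.le, show (-(5 / 4) : ℝ) = -(0 + 1 / 4) - 1 by norm_num,
    Real.rpow_sub_one hpos.ne']
  gcongr
  norm_num

theorem exists_summable_bound_termS (R : ℝ) :
    ∃ u : ℕ → ℝ, Summable u ∧ ∀ (n : ℕ) (s : ℂ), ‖s‖ ≤ R → ‖termS (n + 1) s‖ ≤ u n := by
  obtain ⟨C, hC⟩ := exists_norm_shiftedAltSum_le R 0
  refine ⟨_, summable_rpow_neg_quarter_div C, fun n s hs => ?_⟩
  have hn : ‖((n : ℂ) + 2)‖ = n + 2 := by exact_mod_cast Complex.norm_natCast (n + 2)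
  rw [termS_succ, norm_div, hn]
  gcongr
  exact hC s n hs

/-! ### Evaluation of the series for `1 < Re s` -/

theorem hasSum_pow_div_add_two {t : ℝ} (ht : 0 < t) :
    HasSum (fun n : ℕ => (1 - Real.exp (-t)) ^ n / ((n : ℝ) + 2))
      ((t - (1 - Real.exp (-t))) / (1 - Real.exp (-t)) ^ 2) := by
  have hu : Real.exp (-t) < 1 := Real.exp_lt_one_iff.2 (by linarith)
  have hu0 := Real.exp_pos (-t)
  have h := Real.hasSum_pow_div_log_of_abs_lt_one (x := 1 - Real.exp (-t))
    (by rw [abs_of_pos (by linarith)]; linarith)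
  -- Drop the first term of the series for `-log(1 - u) = t`, then divide by `u²`.
  rw [← hasSum_nat_add_iff' 1] at h
  have h' := h.div_const ((1 - Real.exp (-t)) ^ 2)
  have hne : 1 - Real.exp (-t) ≠ 0 := by linarith
  convert! h' using 2 with n
  · push_cast
    field_simp
    ring
  · simp

theorem hasSum_exp_neg_mul {t : ℝ} (ht : 0 < t) :
    HasSum (fun n : ℕ => Real.exp (-((n : ℝ) + 1) * t)) (Real.exp (-t) / (1 - Real.exp (-t))) := by
  have hu : Real.exp (-t) < 1 := Real.exp_lt_one_iff.2 (by linarith)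
  rw [div_eq_mul_inv]
  refine ((hasSum_geometric_of_lt_one (Real.exp_pos (-t)).le hu).mul_left
    (Real.exp (-t))).congr_fun fun n => ?_
  rw [← Real.exp_nat_mul, ← Real.exp_add]
  ring_nf

theorem hasSum_natCast_mul_exp_neg_mul {t : ℝ} (ht : 0 < t) :
    HasSum (fun n : ℕ => ((n : ℝ) + 1) * Real.exp (-((n : ℝ) + 1) * t))
      (Real.exp (-t) / (1 - Real.exp (-t)) ^ 2) := by
  have hu : Real.exp (-t) < 1 := Real.exp_lt_one_iff.2 (by linarith)
  have h := hasSum_coe_mul_geometric_of_norm_lt_one (r := Real.exp (-t))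
    (by rwa [Real.norm_of_nonneg (Real.exp_pos _).le])
  rw [← hasSum_nat_add_iff' 1] at h
  simp only [Finset.sum_range_one, Nat.cast_zero, zero_mul, sub_zero] at h
  refine h.congr_fun fun n => ?_
  rw [← Real.exp_nat_mul]
  push_cast
  rw [neg_mul, mul_neg]

theorem mellin_exp_neg_div {s : ℂ} (hs : 1 < s.re) :
    mellin (fun t => ((Real.exp (-t) / (1 - Real.exp (-t)) : ℝ) : ℂ)) s =
      Complex.Gamma s * riemannZeta s := by
  have h := hasSum_mellin (a := fun _ : ℕ => (1 : ℂ)) (p := fun n => (n : ℝ) + 1)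
    (F := fun t => ((Real.exp (-t) / (1 - Real.exp (-t)) : ℝ) : ℂ)) (s := s)
    (fun n => Or.inr (by positivity)) (by linarith)
    (fun t ht => by simpa using Complex.hasSum_ofReal.2 (hasSum_exp_neg_mul ht))
    (by simpa using (summable_nat_add_iff 1).2 (Real.summable_nat_rpow_inv.2 hs))
  rw [← h.tsum_eq, zeta_eq_tsum_one_div_nat_add_one_cpow hs, ← tsum_mul_left]
  refine tsum_congr fun n => ?_
  push_cast
  ring

/-- The weight `n` lowers the exponent `s + 1` to `s`, while `Γ(s+1) = s Γ(s)` supplies the factor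
`s`. -/
theorem mellin_exp_neg_div_sq {s : ℂ} (hs : 1 < s.re) :
    mellin (fun t => ((Real.exp (-t) / (1 - Real.exp (-t)) ^ 2 : ℝ) : ℂ)) (s + 1) =
      s * (Complex.Gamma s * riemannZeta s) := by
  have hs0 : s ≠ 0 := fun h => by simp [h] at hs; linarith
  have h := hasSum_mellin (a := fun n : ℕ => (n : ℂ) + 1) (p := fun n => (n : ℝ) + 1)
    (F := fun t => ((Real.exp (-t) / (1 - Real.exp (-t)) ^ 2 : ℝ) : ℂ)) (s := s + 1)
    (fun n => Or.inr (by positivity)) (by simp; linarith)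
    (fun t ht => by simpa using Complex.hasSum_ofReal.2 (hasSum_natCast_mul_exp_neg_mul ht))
    (by
      refine ((summable_nat_add_iff 1).2 (Real.summable_nat_rpow_inv.2 hs)).congr fun n => ?_
      have hn : ‖((n : ℂ) + 1)‖ = n + 1 := by exact_mod_cast Complex.norm_natCast (n + 1)
      have hpos : (0 : ℝ) < n + 1 := by positivity
      rw [hn, Complex.add_re, Complex.one_re, Real.rpow_add_one hpos.ne']
      push_cast
      field_simp)
  rw [← h.tsum_eq, zeta_eq_tsum_one_div_nat_add_one_cpow hs, ← tsum_mul_left, ← tsum_mul_left]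
  refine tsum_congr fun n => ?_
  have hn : (n : ℂ) + 1 ≠ 0 := Nat.cast_add_one_ne_zero n
  push_cast
  rw [Complex.Gamma_add_one s hs0, Complex.cpow_add _ _ hn, Complex.cpow_one]
  field_simp

/-- A non-integrable integrand has integral `0` by convention, so nonvanishing of `Γ(s) ζ(s)` gives
the integrability needed to split the integral. -/
theorem mellinConvergent_of_mellin_ne_zero {f : ℝ → ℂ} {s : ℂ} (h : mellin f s ≠ 0) :
    MellinConvergent f s := by
  by_contra hf
  exact h (integral_undef hf)

/-- The sum over `n` of the Mellin integrands is a difference of two integrands, whose integrals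
are `s Γ(s) ζ(s)` and `Γ(s) ζ(s)`. -/
theorem integral_cpow_mul_exp_neg_mul {s : ℂ} (hs : 1 < s.re) :
    ∫ t : ℝ in Ioi 0, (t : ℂ) ^ (s - 1) * ((Real.exp (-t) *
      ((t - (1 - Real.exp (-t))) / (1 - Real.exp (-t)) ^ 2) : ℝ) : ℂ) =
      Complex.Gamma s * ((s - 1) * riemannZeta s) := by
  have hne : Complex.Gamma s * riemannZeta s ≠ 0 := mul_ne_zero
    (Complex.Gamma_ne_zero_of_re_pos (by linarith)) (riemannZeta_ne_zero_of_one_lt_re hs)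
  have hs0 : s ≠ 0 := fun h => by simp [h] at hs; linarith
  have h₁ := mellinConvergent_of_mellin_ne_zero ((mellin_exp_neg_div hs).trans_ne hne)
  have h₂ := mellinConvergent_of_mellin_ne_zero
    ((mellin_exp_neg_div_sq hs).trans_ne (mul_ne_zero hs0 hne))
  rw [show Complex.Gamma s * ((s - 1) * riemannZeta s) =
    s * (Complex.Gamma s * riemannZeta s) - Complex.Gamma s * riemannZeta s by ring,
    ← mellin_exp_neg_div_sq hs, ← mellin_exp_neg_div hs, mellin, mellin,
    ← integral_sub h₂ h₁]
  refine setIntegral_congr_fun measurableSet_Ioi fun t (ht : 0 < t) => ?_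
  have hu : Real.exp (-t) < 1 := Real.exp_lt_one_iff.2 (by linarith)
  have hd : (1 : ℂ) - (Real.exp (-t) : ℝ) ≠ 0 := by
    rw [sub_ne_zero]; exact_mod_cast hu.ne'
  have ht0 : (t : ℂ) ≠ 0 := by exact_mod_cast ht.ne'
  have hc : (t : ℂ) ^ (s + 1 - 1) = (t : ℂ) ^ (s - 1) * t := by
    rw [show s + 1 - 1 = (s - 1) + 1 by ring, Complex.cpow_add _ _ ht0, Complex.cpow_one]
  simp only [smul_eq_mul, hc, Complex.ofReal_mul, Complex.ofReal_div, Complex.ofReal_sub,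
    Complex.ofReal_pow, Complex.ofReal_one]
  field_simp

theorem integrableOn_mellin_expWeight (i n : ℕ) {s : ℂ} (hs : 1 ≤ s.re) :
    IntegrableOn (fun t : ℝ => (t : ℂ) ^ (s - 1) • expWeight i n t) (Ioi 0) := by
  obtain ⟨N, hN⟩ := exists_nat_ge (s.re - 1)
  refine Integrable.mono' (integrableOn_exp_neg_quarter.const_mul _) ?_
    ((ae_restrict_iff' measurableSet_Ioi).2 (Filter.Eventually.of_forall fun t ht =>
      norm_mellin_expWeight_integrand_le i n N ht hs hN))
  unfold expWeight
  have : Measurable fun t : ℝ => (t : ℂ) ^ (s - 1) • ((Real.exp (-((i + 1) * t)) *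
    (1 - Real.exp (-t)) ^ n : ℝ) : ℂ) := by fun_prop
  exact this.aestronglyMeasurable

theorem hasSum_termS_of_one_lt_re {s : ℂ} (hs : 1 < s.re) :
    HasSum (fun n : ℕ => termS (n + 1) s) ((s - 1) * riemannZeta s) := by
  have hG := Complex.Gamma_ne_zero_of_re_pos (s := s) (by linarith)
  obtain ⟨N, hN⟩ := exists_nat_ge (s.re - 1)
  have hnorm (n : ℕ) : ‖((n : ℂ) + 2)⁻¹‖ = ((n : ℝ) + 2)⁻¹ := by
    rw [norm_inv]; congr 1; exact_mod_cast Complex.norm_natCast (n + 2)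
  have key := hasSum_integral_of_summable_integral_norm (μ := volume.restrict (Ioi 0))
    (F := fun (n : ℕ) (t : ℝ) => ((n : ℂ) + 2)⁻¹ * ((t : ℂ) ^ (s - 1) • expWeight 0 n t))
    (fun n => (integrableOn_mellin_expWeight 0 n hs.le).const_mul _) (by
      refine Summable.of_nonneg_of_le (fun n => integral_nonneg fun _ => norm_nonneg _)
        (fun n => ?_) (summable_rpow_neg_quarter_div
          (2 ^ N * N.factorial * ((0 + 1).factorial * Real.exp 1) * 4))
      simp_rw [norm_mul, hnorm]
      rw [integral_const_mul, div_eq_inv_mul]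
      gcongr
      simpa only [norm_mul] using integral_norm_mellin_expWeight_le 0 n N hs.le hN)
  have hval : ∫ t : ℝ in Ioi 0, ∑' n : ℕ, ((n : ℂ) + 2)⁻¹ * ((t : ℂ) ^ (s - 1) • expWeight 0 n t) =
      Complex.Gamma s * ((s - 1) * riemannZeta s) := by
    rw [← integral_cpow_mul_exp_neg_mul hs]
    refine setIntegral_congr_fun measurableSet_Ioi fun t ht => HasSum.tsum_eq ?_
    have h := (Complex.hasSum_ofReal.2 ((hasSum_pow_div_add_two ht).mul_left
      (Real.exp (-t)))).mul_left ((t : ℂ) ^ (s - 1))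
    refine h.congr_fun fun n => ?_
    simp only [expWeight, smul_eq_mul]
    push_cast
    rw [zero_add, one_mul]
    ring
  rw [hval] at key
  have h := key.mul_left (Complex.Gamma s)⁻¹
  rw [inv_mul_cancel_left₀ hG] at h
  refine h.congr_fun fun n => ?_
  rw [integral_const_mul, termS_succ, div_eq_inv_mul]
  have hm : ∫ t : ℝ in Ioi 0, (t : ℂ) ^ (s - 1) • expWeight 0 n t =
    Complex.Gamma s * shiftedAltSum 0 n s := mellin_expWeight 0 n (by linarith)
  rw [hm]
  field_simp

/-! ### Analytic continuation and the final statement -/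

theorem differentiable_tsum_termS : Differentiable ℂ fun s => ∑' n : ℕ, termS (n + 1) s := by
  intro s
  obtain ⟨u, hu, hb⟩ := exists_summable_bound_termS (‖s‖ + 1)
  have h := Complex.differentiableOn_tsum_of_summable_norm (F := fun (n : ℕ) s => termS (n + 1) s)
    (U := Metric.ball 0 (‖s‖ + 1)) hu (fun n => by
      simp only [termS_succ]
      exact ((differentiable_shiftedAltSum 0 n).div_const _).differentiableOn)
    Metric.isOpen_ball (fun n w hw => hb n w (by simpa using (mem_ball_zero_iff.1 hw).le))
  exact h.differentiableAt (Metric.isOpen_ball.mem_nhds (by simp))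

theorem tsum_termS_eq (s : ℂ) : ∑' n : ℕ, termS (n + 1) s = subOneMulZeta s := by
  refine congrFun (AnalyticOnNhd.eq_of_eventuallyEq (z₀ := 2)
    (fun z _ => differentiable_tsum_termS.analyticAt z)
    (fun z _ => differentiable_subOneMulZeta.analyticAt z) ?_) s
  have ho : IsOpen {z : ℂ | 1 < z.re} := isOpen_lt continuous_const Complex.continuous_re
  filter_upwards [ho.mem_nhds (by simp : (2 : ℂ) ∈ {z : ℂ | 1 < z.re})] with z hz
  have hz1 : z ≠ 1 := fun h => by simp [h] at hz
  rw [(hasSum_termS_of_one_lt_re hz).tsum_eq, subOneMulZeta, Function.update_of_ne hz1]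

theorem theorem2p1 :
    (∀ s : ℂ,
      HasSum (fun n : ℕ => termS (n + 1) s) (subOneMulZeta s) ∧
      subOneMulZeta s = ∑' n : ℕ, termS (n + 1) s ∧
      HasSum (fun n : ℕ => termDelta (n + 1) s) (-subOneMulZeta s) ∧
      subOneMulZeta s = -∑' n : ℕ, termDelta (n + 1) s) ∧
    (∀ K : Set ℂ, IsCompact K →
      HasSumUniformlyOn (fun (n : ℕ) (s : ℂ) => termS (n + 1) s) subOneMulZeta K ∧
      SummableUniformlyOn (fun (n : ℕ) (s : ℂ) => ‖termS (n + 1) s‖) K ∧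
      HasSumUniformlyOn (fun (n : ℕ) (s : ℂ) => termDelta (n + 1) s)
        (fun s => -subOneMulZeta s) K ∧
      SummableUniformlyOn (fun (n : ℕ) (s : ℂ) => ‖termDelta (n + 1) s‖) K) := by
  have hS (s : ℂ) : HasSum (fun n : ℕ => termS (n + 1) s) (subOneMulZeta s) := by
    obtain ⟨u, hu, hb⟩ := exists_summable_bound_termS ‖s‖
    rw [← tsum_termS_eq]
    exact (hu.of_norm_bounded fun n => hb n s le_rfl).hasSum
  have hD (s : ℂ) : HasSum (fun n : ℕ => termDelta (n + 1) s) (-subOneMulZeta s) := by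
    simpa only [termDelta_succ] using (hS s).neg
  refine ⟨fun s => ⟨hS s, (hS s).tsum_eq.symm, hD s, by rw [(hD s).tsum_eq, neg_neg]⟩,
    fun K hK => ?_⟩
  obtain ⟨R, hR⟩ := hK.isBounded.exists_norm_le
  obtain ⟨u, hu, hb⟩ := exists_summable_bound_termS R
  have hbS (n : ℕ) (s : ℂ) (hs : s ∈ K) : ‖termS (n + 1) s‖ ≤ u n := hb n s (hR s hs)
  have hbD (n : ℕ) (s : ℂ) (hs : s ∈ K) : ‖termDelta (n + 1) s‖ ≤ u n := by
    rw [termDelta_succ, norm_neg]; exact hbS n s hs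
  exact ⟨(HasSumUniformlyOn.of_norm_le_summable hu hbS).congr_right
      fun s _ => (hS s).tsum_eq,
    (HasSumUniformlyOn.of_norm_le_summable hu
      fun n s hs => (norm_norm _).trans_le (hbS n s hs)).summableUniformlyOn,
    (HasSumUniformlyOn.of_norm_le_summable hu hbD).congr_right fun s _ => (hD s).tsum_eq,
    (HasSumUniformlyOn.of_norm_le_summable hu
      fun n s hs => (norm_norm _).trans_le (hbD n s hs)).summableUniformlyOn⟩
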